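/- Let $q\in\mathbb{C}\setminus\{0\}$ be not a root of unity, let $M,N\ge 0$ be integers, and let $I=\{1,\dots,M+N-1\}$ (empty if $M+N\le 1$). For $1\le a,b\le M+N$ put $l_a=1$ if $a\le M$, $l_a=-1$ if $a>M$, and $(\epsilon_a,\epsilon_b)=l_a\delta_{a,b}$; for $i,j\in I$ put $q_i=q^{l_i}$ and $c_{i,j}=(\epsilon_i-\epsilon_{i+1},\epsilon_j-\epsilon_{j+1})$. For homogeneous elements $a,b$ of a superalgebra put $[a,b]_u=ab-(-1)^{|a||b|}u\,ba$ and $[a,b]=[a,b]_1$; put $[k]_v=\frac{v^k-v^{-k}}{v-v^{-1}}$. Let $U_q(\mathcal{L}\mathfrak{sl}(M,N))$ be the superalgebra over $\mathbb{C}$ with generators $X_{i,n}^{\pm},K_i^{\pm1},h_{i,s}$ ($i\in I$, $n\in\mathbb{Z}$, $s\in\mathbb{Z}_{\neq0}$), where the $X_{M,n}^{\pm}$ are odd and all other generators are even, and with the following relations for all $i,j\in I$, $m,n,k,u\in\mathbb{Z}$, $s,t\in\mathbb{Z}_{\ne0}$: \begin{align*} & K_iK_i^{-1}=1=K_i^{-1}K_i,\quad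 [K_i,K_j]=[K_i,h_{j,s}]=[h_{i,s},h_{j,t}]=0,\\ & K_iX_{j,n}^{\pm}K_i^{-1}=q^{\pm c_{i,j}}X_{j,n}^{\pm},\quad [h_{i,s},X_{j,n}^{\pm}]=\pm\tfrac{[sl_ic_{i,j}]_{q_i}}{s}X_{j,n+s}^{\pm},\\ & [X_{i,m}^+,X_{j,n}^-]=\delta_{i,j}\,\frac{\phi_{i,m+n}^+-\phi_{i,m+n}^-}{q_i-q_i^{-1}},\\ & [X_{i,m}^{\pm},X_{j,n}^{\pm}]=0\quad\text{if } c_{i,j}=0,\\ & X_{i,m+1}^{\pm}X_{j,n}^{\pm}-q^{\pm c_{i,j}}X_{j,n}^{\pm}X_{i,m+1}^{\pm}=q^{\pm c_{i,j}}X_{i,m}^{\pm}X_{j,n+1}^{\pm}-X_{j,n+1}^{\pm}X_{i,m}^{\pm}\quad\text{if } c_{i,j}\ne0,\\ & [X_{i,m}^{\pm},[X_{i,n}^{\pm},X_{j,k}^{\pm}]_{q^{-1}}]_q+[X_{i,n}^{\pm},[X_{i,m}^{\pm},X_{j,k}^{\pm}]_{q^{-1}}]_q=0\quad\text{if } c_{i,j}=\pm1,\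 i\ne M,\\ & [[[X_{M-1,m}^{\pm},X_{M,n}^{\pm}]_{q^{-1}},X_{M+1,k}^{\pm}]_q,X_{M,u}^{\pm}]+[[[X_{M-1,m}^{\pm},X_{M,u}^{\pm}]_{q^{-1}},X_{M+1,k}^{\pm}]_q,X_{M,n}^{\pm}]=0\quad\text{if } M,N>1, \end{align*} where $\sum_{n\in\mathbb{Z}}\phi_{i,n}^{\pm}z^n=K_i^{\pm1}\exp\bigl(\pm(q_i-q_i^{-1})\sum_{s>0}h_{i,\pm s}z^{\pm s}\bigr)$. Let $U_q^+(\mathcal{L}\mathfrak{sl}(M,N))$ be the subalgebra generated by all $X_{i,n}^+$ ($i\in I$, $n\in\mathbb{Z}$). Let $\Delta=\{\alpha_i+\alpha_{i+1}+\cdots+\alpha_j : i\le j \text{ in } I\}$ be the set of positive roots, where the simple roots $\alpha_i$ are linearly independent symbols, totally ordered by $\alpha_i+\cdots+\alpha_j<\alpha_{i'}+\cdots+\alpha_{j'}$ if $i<i'$, or $i=i'$ and $j<j'$. For $\beta=\alpha_i+\cdots+\alpha_j\in\Delta$ and $n\in\mathbb{Z}$ define the root vector \[X_\beta(n)=[\cdots[[X_{i,n}^+,X_{i+1,0}^+]_{q_{i+1}},X_{i+2,0}^+]_{q_{i+2}},\cdots,X_{j,0}^+]_{q_j},\qquad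 X_{\alpha_i}(n)=X_{i,n}^+.\] **Theorem.** The vector space $U_q^+(\mathcal{L}\mathfrak{sl}(M,N))$ is spanned over $\mathbb{C}$ by the ordered products \[\prod_{\beta\in\Delta}^{\rightarrow}\Bigl(\prod_{i=1}^{c_\beta}X_\beta(n_{i,\beta})\Bigr),\] where $c_\beta\in\mathbb{Z}_{\ge0}$ for $\beta\in\Delta$, $n_{i,\beta}\in\mathbb{Z}$ for $1\le i\le c_\beta$, and the roots increase from left to right. -/

import Mathlib

namespace QAff

/-! ### Super-brackets -/

/-- An element of an algebra labelled by its `ℤ/2`-degree. -/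
structure SuperElt (A : Type*) where
  deg : ZMod 2
  val : A

/-- The super-bracket `[a, b]_u = a b - (-1)^{|a||b|} u b a`, of degree `|a| + |b|`. -/
def sbr {A : Type*} [Ring A] [Algebra ℂ A] (u : ℂ) (a b : SuperElt A) : SuperElt A where
  deg := a.deg + b.deg
  val := a.val * b.val - ((-1 : ℂ) ^ (a.deg * b.deg).val * u) • (b.val * a.val)

/-! ### Combinatorial data of `sl(M,N)`

The nodes `1, …, M+N-1` of the Dynkin diagram are indexed by `i : Fin (M + N - 1)`;
the term `i` stands for the node `i + 1`.  In the same way the natural number `a` stands for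
the basis vector `ε_{a+1}`. -/

/-- `l_{a+1}`: it is `1` for `a + 1 ≤ M` and `-1` for `a + 1 > M`. -/
def sgn (M : ℕ) (a : ℕ) : ℤ := if a + 1 ≤ M then 1 else -1

/-- The bilinear form `(ε_{a+1}, ε_{b+1}) = l_{a+1} δ_{a,b}` on basis vectors. -/
def epsForm (M : ℕ) (a b : ℕ) : ℤ := if a = b then sgn M a else 0

/-- `(ε_{i+1} - ε_{i+2}, ε_{j+1} - ε_{j+2})`, the entry `c_{i+1,j+1}`. -/
def cartan (M : ℕ) (i j : ℕ) : ℤ :=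
  epsForm M i j - epsForm M i (j + 1) - epsForm M (i + 1) j + epsForm M (i + 1) (j + 1)

/-- `q_{i+1} = q ^ l_{i+1}`. -/
noncomputable def qn (q : ℂ) (M : ℕ) (i : ℕ) : ℂ := q ^ sgn M i

/-- The `v`-integer `[a]_v = (v^a - v^{-a}) / (v - v^{-1})`. -/
noncomputable def vInt (v : ℂ) (a : ℤ) : ℂ := (v ^ a - v ^ (-a)) / (v - v⁻¹)

/-- The parity of the node `i + 1`: only the node `M` is odd. -/
def nodeParity (M : ℕ) (i : ℕ) : ZMod 2 := if i + 1 = M then 1 else 0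

/-! ### The Drinfel'd presentation -/

/-- The generators `X_{i,n}^±`, `K_i^{±1}`, `h_{i,s}` (`s ≠ 0`); a sign is a unit of `ℤ`. -/
inductive Gen (M N : ℕ) : Type
  | X (e : ℤˣ) (i : Fin (M + N - 1)) (n : ℤ) : Gen M N
  | K (e : ℤˣ) (i : Fin (M + N - 1)) : Gen M N
  | h (i : Fin (M + N - 1)) (s : {s : ℤ // s ≠ 0}) : Gen M N

/-- The free algebra on the generators. -/
abbrev Free (M N : ℕ) : Type := FreeAlgebra ℂ (Gen M N)

noncomputable section

/-- `X_{i,n}^±` in the free algebra, with its degree. -/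
def fX {M N : ℕ} (e : ℤˣ) (i : Fin (M + N - 1)) (n : ℤ) : SuperElt (Free M N) :=
  ⟨nodeParity M i, FreeAlgebra.ι ℂ (Gen.X e i n)⟩

/-- `K_i^{±1}` in the free algebra. -/
def fK {M N : ℕ} (e : ℤˣ) (i : Fin (M + N - 1)) : Free M N := FreeAlgebra.ι ℂ (Gen.K e i)

/-- `h_{i,s}` in the free algebra. -/
def fh {M N : ℕ} (i : Fin (M + N - 1)) (s : {s : ℤ // s ≠ 0}) : Free M N :=
  FreeAlgebra.ι ℂ (Gen.h i s)

/-- The power series `±(q_i - q_i^{-1}) ∑_{s > 0} h_{i,±s} w^s`, where `w = z^{±1}`. -/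
def hSeries {M N : ℕ} (q : ℂ) (e : ℤˣ) (i : Fin (M + N - 1)) : PowerSeries (Free M N) :=
  PowerSeries.mk fun s =>
    if hs : (e : ℤ) * (s : ℤ) ≠ 0 then
      (((e : ℤ) : ℂ) * (qn q M i - (qn q M i)⁻¹)) • fh i ⟨(e : ℤ) * (s : ℤ), hs⟩
    else 0

/-- The coefficient of `w^k` in `exp f = ∑_r f^r / r!`, for a power series `f` without constant
term (so that `f^r` contributes nothing when `r > k`). -/
def expCoeff {A : Type*} [Ring A] [Algebra ℂ A] (f : PowerSeries A) (k : ℕ) : A :=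
  ∑ r ∈ Finset.range (k + 1), ((r.factorial : ℂ)⁻¹) • PowerSeries.coeff k (f ^ r)

/-- `φ_{i,n}^±`, the coefficient of `z^n` in
`K_i^{±1} exp (±(q_i - q_i^{-1}) ∑_{s > 0} h_{i,±s} z^{±s})`; it is `0` unless `±n ≥ 0`. -/
def phi {M N : ℕ} (q : ℂ) (e : ℤˣ) (i : Fin (M + N - 1)) (n : ℤ) : Free M N :=
  if 0 ≤ (e : ℤ) * n then fK e i * expCoeff (hSeries q e i) n.natAbs else 0

/-- The defining relations of `U_q(L sl(M,N))`. -/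
inductive Rel (M N : ℕ) (q : ℂ) : Free M N → Free M N → Prop
  | K_inv (e : ℤˣ) (i) : Rel M N q (fK e i * fK (-e) i) 1
  | K_K (i j) : Rel M N q (fK 1 i * fK 1 j) (fK 1 j * fK 1 i)
  | K_h (i j s) : Rel M N q (fK 1 i * fh j s) (fh j s * fK 1 i)
  | h_h (i j s t) : Rel M N q (fh i s * fh j t) (fh j t * fh i s)
  | K_X (e : ℤˣ) (i j : Fin (M + N - 1)) (n : ℤ) :
      Rel M N q (fK 1 i * (fX e j n).val * fK (-1) i)
        (q ^ ((e : ℤ) * cartan M i j) • (fX e j n).val)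
  | h_X (e : ℤˣ) (i j : Fin (M + N - 1)) (s : {s : ℤ // s ≠ 0}) (n : ℤ) :
      Rel M N q (fh i s * (fX e j n).val - (fX e j n).val * fh i s)
        ((((e : ℤ) : ℂ) * (vInt (qn q M i) (s.val * sgn M i * cartan M i j) / (s.val : ℂ))) •
          (fX e j (n + s.val)).val)
  | X_X (i j : Fin (M + N - 1)) (m n : ℤ) :
      Rel M N q (sbr 1 (fX 1 i m) (fX (-1) j n)).val
        (if i = j then
          (qn q M i - (qn q M i)⁻¹)⁻¹ • (phi q 1 i (m + n) - phi q (-1) i (m + n))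
        else 0)
  | comm (e : ℤˣ) (i j : Fin (M + N - 1)) (m n : ℤ) (hc : cartan M i j = 0) :
      Rel M N q (sbr 1 (fX e i m) (fX e j n)).val 0
  | quad (e : ℤˣ) (i j : Fin (M + N - 1)) (m n : ℤ) (hc : cartan M i j ≠ 0) :
      Rel M N q
        ((fX e i (m + 1)).val * (fX e j n).val
          - q ^ ((e : ℤ) * cartan M i j) • ((fX e j n).val * (fX e i (m + 1)).val))
        (q ^ ((e : ℤ) * cartan M i j) • ((fX e i m).val * (fX e j (n + 1)).val)
          - (fX e j (n + 1)).val * (fX e i m).val)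
  | serre (e : ℤˣ) (i j : Fin (M + N - 1)) (m n k : ℤ)
      (hc : cartan M i j = 1 ∨ cartan M i j = -1) (hi : (i : ℕ) + 1 ≠ M) :
      Rel M N q
        ((sbr q (fX e i m) (sbr q⁻¹ (fX e i n) (fX e j k))).val
          + (sbr q (fX e i n) (sbr q⁻¹ (fX e i m) (fX e j k))).val) 0
  /- Here `a`, `b`, `c` are the nodes `M - 1`, `M`, `M + 1`; they exist only if `M, N > 1`. -/
  | oscillation (e : ℤˣ) (a b c : Fin (M + N - 1)) (m n k u : ℤ)
      (hb : (b : ℕ) + 1 = M) (ha : (a : ℕ) + 1 = b) (hc : (c : ℕ) = b + 1) :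
      Rel M N q
        ((sbr 1 (sbr q (sbr q⁻¹ (fX e a m) (fX e b n)) (fX e c k)) (fX e b u)).val
          + (sbr 1 (sbr q (sbr q⁻¹ (fX e a m) (fX e b u)) (fX e c k)) (fX e b n)).val) 0

/-- The quantum affine superalgebra `U_q(L sl(M,N))`. -/
abbrev Uq (M N : ℕ) (q : ℂ) : Type := RingQuot (Rel M N q)

/-- The generator `X_{i,n}^+` of `U_q(L sl(M,N))`, with its degree. -/
def Xp {M N : ℕ} (q : ℂ) (i : Fin (M + N - 1)) (n : ℤ) : SuperElt (Uq M N q) :=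
  ⟨nodeParity M i, RingQuot.mkAlgHom ℂ (Rel M N q) (fX 1 i n).val⟩

/-- The subalgebra `U_q^+(L sl(M,N))` generated by the `X_{i,n}^+`. -/
def UqPlus (M N : ℕ) (q : ℂ) : Subalgebra ℂ (Uq M N q) :=
  Algebra.adjoin ℂ {x | ∃ (i : Fin (M + N - 1)) (n : ℤ), x = (Xp q i n).val}

/-! ### Root vectors and ordered products -/

/-- The positive roots `α_i + ⋯ + α_j` with `i ≤ j`, as pairs `(i, j)` in lexicographic order. -/
abbrev PosRoot (M N : ℕ) : Type :=
  {p : Fin (M + N - 1) ×ₗ Fin (M + N - 1) // (ofLex p).1 ≤ (ofLex p).2}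

/-- The iterated bracket
`[⋯[[X_{i,n}^+, X_{i+1,0}^+]_{q_{i+1}}, X_{i+2,0}^+]_{q_{i+2}}, ⋯, X_{i+d,0}^+]_{q_{i+d}}`. -/
def iterBr {M N : ℕ} (q : ℂ) (i : Fin (M + N - 1)) (n : ℤ) :
    (d : ℕ) → (i : ℕ) + d < M + N - 1 → SuperElt (Uq M N q)
  | 0, _ => Xp q i n
  | d + 1, hd =>
      sbr (qn q M (i + (d + 1))) (iterBr q i n d (by omega)) (Xp q ⟨i + (d + 1), hd⟩ 0)

/-- The root vector `X_β(n)`. -/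
def rootVector {M N : ℕ} (q : ℂ) (β : PosRoot M N) (n : ℤ) : Uq M N q :=
  (iterBr q (ofLex β.val).1 n ((ofLex β.val).2 - (ofLex β.val).1 : ℕ) (by
    have h1 : ((ofLex β.val).1 : ℕ) ≤ (ofLex β.val).2 := β.property
    have h2 := (ofLex β.val).2.isLt
    omega)).val

/-- The ordered product `∏_β^→ (∏_{i=1}^{c_β} X_β(n_{i,β}))`, the roots in increasing order from
left to right. -/
def pbwProduct {M N : ℕ} (q : ℂ) (c : PosRoot M N → ℕ) (n : (β : PosRoot M N) → Fin (c β) → ℤ) :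
    Uq M N q :=
  (((Finset.univ : Finset (PosRoot M N)).sort (· ≤ ·)).map fun β =>
    (List.ofFn fun t : Fin (c β) => rootVector q β (n β t)).prod).prod

end

end QAff

/-! ### Sign-free relations, root vectors and the modules they generate -/

namespace QAff

/-! Fix a node `i`. Write Y_d(n) for the root vector on the nodes i, …, i+d, write T for the algebra
generated by the later nodes, and D for the right T-module generated by all Y_d(n) (`degOne`). Two
facts carry the theorem. First, T D ⊆ D (`tail_mul_degOne`), so later nodes can be pushed to the
right of root vectors. Second, for e ≤ d the product Y_{d+1}(m) Y_e(n) lies in the span of the Y_f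
with f ≤ d, times D (`rootVec_mul_rootVec`): a pair in the wrong order is rewritten with a shorter
first factor, so sorting terminates (`rootVec_mul_sortedMod`). Hence the algebra of the nodes ≥ i is
spanned by sorted products of the Y_d times T (`tailAlg_le`), and descending induction on `i`
finishes (`tailAlg_le_span`).

Both facts reduce to relations with equal modes. By the quadratic relation of neighbouring nodes,
x_{i+d+1}(m+1) Y_d(n) equals a nonzero multiple of x_{i+d+1}(m) Y_d(n+1) up to terms already under
control, so a mode can be slid from one factor to another (`mode_transfer`). It is slid either to 0,
where the defining bracket of Y_{d+1} appears, or to the mode of another factor, where the Serre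
relation (even node), the vanishing square or the oscillation relation (odd node) applies. The modes
in the spanning products are unordered, so the exchange relation of a node with itself never enters.
-/

/-- A family `x k n` of elements of an algebra (`k` a node, `n` a mode) satisfying the consequences
of the Drinfel'd relations for positive generators that do not involve super-signs. -/
structure LoopSerre {A : Type*} [Ring A] [Algebra ℂ A] (x : ℕ → ℤ → A) (p : ℕ → ℂ) (s : ℂ)
    (odd : ℕ → Prop) : Prop where
  p_ne : ∀ k, p k ≠ 0
  s_ne : s ≠ 0
  far : ∀ k l m n, k + 2 ≤ l → x l n * x k m = x k m * x l n
  quad : ∀ k m n, p (k + 1) • (x (k + 1) (n + 1) * x k m) =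
    x k m * x (k + 1) (n + 1) - p (k + 1) • (x k (m + 1) * x (k + 1) n)
      + x (k + 1) n * x k (m + 1)
  serre : ∀ k l m n, ¬ odd k → (l = k + 1 ∨ k = l + 1) →
    x k m * x k m * x l n - s • (x k m * x l n * x k m) + x l n * x k m * x k m = 0
  odd_sq : ∀ k m, odd k → x k m * x k m = 0
  osc : ∀ k a b c, odd (k + 1) →
    x k a * x (k + 1) b * x (k + 2) c * x (k + 1) b
      + x (k + 2) c * x (k + 1) b * x k a * x (k + 1) b
      + x (k + 1) b * x k a * x (k + 1) b * x (k + 2) c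
      + x (k + 1) b * x (k + 2) c * x (k + 1) b * x k a
      - s • (x (k + 1) b * x (k + 2) c * x k a * x (k + 1) b) = 0

section

variable {A : Type*} [Ring A] [Algebra ℂ A]

/-- The root vectors `[⋯[x i n, x (i+1) 0]_{p (i+1)}, ⋯, x (i+d) 0]_{p (i+d)}`. -/
def rootVec (x : ℕ → ℤ → A) (p : ℕ → ℂ) (i : ℕ) : ℕ → ℤ → A
  | 0, n => x i n
  | d + 1, n => rootVec x p i d n * x (i + d + 1) 0
      - p (i + d + 1) • (x (i + d + 1) 0 * rootVec x p i d n)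

/-- The subalgebra generated by the `x k n` with `i ≤ k`. -/
def tailAlg (x : ℕ → ℤ → A) (i : ℕ) : Subalgebra ℂ A :=
  Algebra.adjoin ℂ {y | ∃ k n, i ≤ k ∧ y = x k n}

/-- The span of the root vectors starting at `i` of length at most `d`. -/
def rootSpan (x : ℕ → ℤ → A) (p : ℕ → ℂ) (i d : ℕ) : Submodule ℂ A :=
  Submodule.span ℂ {y | ∃ e n, e ≤ d ∧ y = rootVec x p i e n}

/-- The right module over `tailAlg x (i+1)` generated by the root vectors starting at `i` of length
at most `d`. -/
def rootMod (x : ℕ → ℤ → A) (p : ℕ → ℂ) (i d : ℕ) : Submodule ℂ A :=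
  rootSpan x p i d * Subalgebra.toSubmodule (tailAlg x (i + 1))

/-- The right module over `tailAlg x (i+1)` generated by all root vectors starting at `i`. -/
def degOne (x : ℕ → ℤ → A) (p : ℕ → ℂ) (i : ℕ) : Submodule ℂ A :=
  Submodule.span ℂ {y | ∃ e n, y = rootVec x p i e n} *
    Subalgebra.toSubmodule (tailAlg x (i + 1))

/-- A family `f m n` whose diagonals `m + n = const` are proportional modulo `S` lies in `S` on a
whole diagonal as soon as it does at one place. -/
theorem mode_transfer (S : Submodule ℂ A) {c : ℂ} (hc : c ≠ 0) (f : ℤ → ℤ → A)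
    (hf : ∀ m n, f (m + 1) n - c • f m (n + 1) ∈ S) (m' m n : ℤ)
    (h : f m' (n + m - m') ∈ S) : f m n ∈ S := by
  suffices H : ∀ t : ℤ, f (m' + t) (n + m - m' - t) ∈ S by
    have := H (m - m')
    convert this using 2 <;> ring
  intro t
  induction t using Int.induction_on with
  | zero => simpa using h
  | succ t ih =>
    have h1 := hf (m' + t) (n + m - m' - (t + 1))
    have e1 : n + m - m' - ((t : ℤ) + 1) + 1 = n + m - m' - t := by ring
    rw [e1, add_assoc] at h1
    simpa using S.add_mem h1 (S.smul_mem c ih)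
  | pred t ih =>
    have h1 := hf (m' + (-t - 1)) (n + m - m' - -t)
    have e1 : n + m - m' - (-(t : ℤ)) + 1 = n + m - m' - (-t - 1) := by ring
    have e2 : m' + (-(t : ℤ) - 1) + 1 = m' + -t := by ring
    rw [e1, e2] at h1
    have h2 := S.sub_mem ih h1
    rw [sub_sub_cancel] at h2
    exact (S.smul_mem_iff hc).1 h2

namespace LoopSerre

variable {x : ℕ → ℤ → A} {p : ℕ → ℂ} {s : ℂ} {odd : ℕ → Prop}

theorem x_mem_tailAlg {i k : ℕ} (hk : i ≤ k) (n : ℤ) : x k n ∈ tailAlg x i :=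
  Algebra.subset_adjoin ⟨k, n, hk, rfl⟩

theorem mul_mem_rootMod {i d : ℕ} {a g : A} (ha : a ∈ rootMod x p i d)
    (hg : g ∈ tailAlg x (i + 1)) : a * g ∈ rootMod x p i d := by
  have h := Submodule.mul_mem_mul ha (show g ∈ Subalgebra.toSubmodule (tailAlg x (i + 1)) from hg)
  rwa [rootMod, mul_assoc, Subalgebra.isIdempotentElem_toSubmodule _] at h

theorem mul_x_mem_rootMod {i d k : ℕ} {a : A} (ha : a ∈ rootMod x p i d) (hk : i + 1 ≤ k)
    (n : ℤ) : a * x k n ∈ rootMod x p i d :=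
  mul_mem_rootMod ha (x_mem_tailAlg hk n)

theorem rootVec_mem_rootSpan {i e d : ℕ} (h : e ≤ d) (n : ℤ) :
    rootVec x p i e n ∈ rootSpan x p i d :=
  Submodule.subset_span ⟨e, n, h, rfl⟩

theorem rootVec_mem_rootMod {i e d : ℕ} (h : e ≤ d) (n : ℤ) :
    rootVec x p i e n ∈ rootMod x p i d := by
  have := Submodule.mul_mem_mul (rootVec_mem_rootSpan (x := x) (p := p) (i := i) h n)
    (show (1 : A) ∈ Subalgebra.toSubmodule (tailAlg x (i + 1)) from one_mem (tailAlg x (i + 1)))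
  rwa [mul_one] at this

theorem rootSpan_mono {i d e : ℕ} (h : d ≤ e) : rootSpan x p i d ≤ rootSpan x p i e := by
  refine Submodule.span_mono ?_
  rintro _ ⟨f, n, hf, rfl⟩
  exact ⟨f, n, hf.trans h, rfl⟩

theorem rootMod_mono {i d e : ℕ} (h : d ≤ e) : rootMod x p i d ≤ rootMod x p i e :=
  mul_le_mul' (rootSpan_mono h) le_rfl

theorem rootMod_le_degOne {i d : ℕ} : rootMod x p i d ≤ degOne x p i := by
  refine mul_le_mul' (Submodule.span_mono ?_) le_rfl
  rintro _ ⟨f, n, -, rfl⟩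
  exact ⟨f, n, rfl⟩

/-- Reduces stability under left multiplication by `u` to the generators of a right module; `P`
absorbs their images and `R` supplies the right factors. -/
theorem mul_left_mem {P R S : Submodule ℂ A} {Y : Set A} {u : A}
    (h : ∀ y ∈ Y, u * y ∈ P) (hPR : P * R ≤ S) {a : A} (ha : a ∈ Submodule.span ℂ Y * R) :
    u * a ∈ S := by
  have h1 : Submodule.span ℂ Y ≤ P.comap (LinearMap.mulLeft ℂ u) :=
    Submodule.span_le.2 fun y hy => h y hy
  have h2 : Submodule.span ℂ Y * R ≤ S.comap (LinearMap.mulLeft ℂ u) := by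
    refine Submodule.mul_le.2 fun y hy r hr => ?_
    have := hPR (Submodule.mul_mem_mul (h1 hy) hr)
    simpa [mul_assoc] using this
  exact h2 ha

theorem rootMod_mul_tail {i d : ℕ} :
    rootMod x p i d * Subalgebra.toSubmodule (tailAlg x (i + 1)) ≤ rootMod x p i d := by
  rw [rootMod, mul_assoc, Subalgebra.isIdempotentElem_toSubmodule _]

theorem mul_rootMod {i d e : ℕ} {u : A}
    (h : ∀ f ≤ d, ∀ n, u * rootVec x p i f n ∈ rootMod x p i e) {a : A}
    (ha : a ∈ rootMod x p i d) : u * a ∈ rootMod x p i e := by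
  refine mul_left_mem (P := rootMod x p i e) ?_ rootMod_mul_tail ha
  rintro _ ⟨f, n, hf, rfl⟩
  exact h f hf n

/-! ### Left multiplication of one root vector by a later node -/

theorem far_rootVec (h : LoopSerre x p s odd) (i d k : ℕ) (hk : i + d + 2 ≤ k) (m n : ℤ) :
    x k m * rootVec x p i d n = rootVec x p i d n * x k m := by
  induction d with
  | zero => exact h.far _ _ _ _ hk
  | succ d ih =>
    have h1 := ih (by omega)
    have h2 := h.far (i + d + 1) k 0 m (by omega)
    simp only [rootVec, mul_sub, sub_mul, mul_smul_comm, smul_mul_assoc]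
    rw [← mul_assoc, h1, mul_assoc, h2, ← mul_assoc, ← mul_assoc, h2, mul_assoc _ (x k m), h1,
      ← mul_assoc]

theorem far_rootMod (h : LoopSerre x p s odd) {i d k : ℕ} (hk : i + d + 2 ≤ k) (m : ℤ) {a : A}
    (ha : a ∈ rootMod x p i d) : x k m * a ∈ rootMod x p i d := by
  refine mul_rootMod (fun f hf n => ?_) ha
  rw [h.far_rootVec i f k (by omega)]
  exact mul_x_mem_rootMod (rootVec_mem_rootMod hf n) (by omega) _

/-- Kept apart from the shift relation because the induction proving that relation uses this
consequence at each stage. -/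
theorem next_of_shift (h : LoopSerre x p s odd) {i d : ℕ} {c : ℂ} (hc : c ≠ 0)
    (hs : ∀ m n, x (i + d + 1) (m + 1) * rootVec x p i d n
      - c • (x (i + d + 1) m * rootVec x p i d (n + 1)) ∈ rootMod x p i d) (m n : ℤ) :
    x (i + d + 1) m * rootVec x p i d n ∈ rootMod x p i (d + 1) := by
  -- Mode 0 is the one occurring in the bracket that defines the root vector of index `d + 1`.
  refine mode_transfer _ hc (fun m n => x (i + d + 1) m * rootVec x p i d n)
    (fun m n => rootMod_mono (Nat.le_succ d) (hs m n)) 0 m n ?_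
  rw [← Submodule.smul_mem_iff _ (h.p_ne (i + d + 1))]
  set n' := n + m - 0
  have e : p (i + d + 1) • (x (i + d + 1) 0 * rootVec x p i d n')
      = rootVec x p i d n' * x (i + d + 1) 0 - rootVec x p i (d + 1) n' := by
    rw [rootVec]; abel
  rw [e]
  exact Submodule.sub_mem _ (mul_x_mem_rootMod (rootVec_mem_rootMod (by omega) _) (by omega) _)
    (rootVec_mem_rootMod le_rfl _)

/-- The error term must lie in `rootMod x p i d`, not merely in index `d + 1`: in the inductive step
node `i + d + 2` multiplies it from the left, and this preserves only index `d`. -/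
theorem x_next_mul_rootVec_shift (h : LoopSerre x p s odd)
    (i d : ℕ) : ∃ c : ℂ, c ≠ 0 ∧ ∀ m n, x (i + d + 1) (m + 1) * rootVec x p i d n
      - c • (x (i + d + 1) m * rootVec x p i d (n + 1)) ∈ rootMod x p i d := by
  induction d with
  | zero =>
    refine ⟨(p (i + 1))⁻¹, inv_ne_zero (h.p_ne _), fun m n => ?_⟩
    rw [← Submodule.smul_mem_iff _ (h.p_ne (i + 1)), smul_sub,
      smul_inv_smul₀ (h.p_ne (i + 1))]
    simp only [rootVec, add_zero]
    rw [h.quad, add_sub_cancel_right]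
    exact Submodule.sub_mem _
      (mul_x_mem_rootMod (rootVec_mem_rootMod (e := 0) le_rfl _) le_rfl _)
      (Submodule.smul_mem _ _
        (mul_x_mem_rootMod (rootVec_mem_rootMod (e := 0) le_rfl _) le_rfl _))
  | succ d ih =>
    obtain ⟨c, hc, hs⟩ := ih
    have hnext := h.next_of_shift hc hs
    refine ⟨(p (i + d + 2))⁻¹ * c, mul_ne_zero (inv_ne_zero (h.p_ne _)) hc, fun m n => ?_⟩
    have hX : i + (d + 1) + 1 = i + d + 2 := by omega
    rw [hX]
    rw [← Submodule.smul_mem_iff _ (h.p_ne (i + d + 2)), smul_sub, mul_smul,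
      smul_inv_smul₀ (h.p_ne (i + d + 2))]
    simp only [rootVec]
    have q1 := h.quad (i + d + 1) 0 m
    have f1 := h.far_rootVec i d (i + d + 2) le_rfl (m + 1) n
    have f2 := h.far_rootVec i d (i + d + 2) le_rfl m n
    have f3 := h.far_rootVec i d (i + d + 2) le_rfl m (n + 1)
    have n0 := hnext 0 n
    have n1 := hnext 1 n
    have s0 := hs 0 n
    rw [zero_add] at s0 q1
    generalize hB : rootVec x p i d n = B at *
    generalize hB' : rootVec x p i d (n + 1) = B' at *
    have mB : B ∈ rootMod x p i (d + 1) := hB ▸ rootVec_mem_rootMod (by omega) _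
    have mB' : B' ∈ rootMod x p i (d + 1) := hB' ▸ rootVec_mem_rootMod (by omega) _
    have s1 := rootMod_mono (Nat.le_succ d) (h.far_rootMod le_rfl m s0)
    have i1 : i + 1 ≤ i + d + 1 := by omega
    have i2 : i + 1 ≤ i + d + 2 := by omega
    have k1 := mul_x_mem_rootMod (mul_x_mem_rootMod mB i2 (m + 1)) i1 0
    have k2 := mul_x_mem_rootMod (mul_x_mem_rootMod mB' i2 m) i1 0
    have k3 := mul_x_mem_rootMod n0 i2 (m + 1)
    have k4 := mul_x_mem_rootMod n1 i2 m
    generalize x (i + d + 2) (m + 1) = X' at *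
    generalize x (i + d + 2) m = X at *
    generalize x (i + d + 1) 0 = E at *
    generalize hE1 : x (i + d + 1) 1 = E1 at *
    generalize p (i + d + 2) = P at *
    generalize p (i + d + 1) = r at *
    -- Here X and X' commute with B and B', and the quadratic relation moves X' past E. The bracket
    -- in the last summand is the error term of the induction hypothesis.
    have key : P • (X' * (B * E - r • (E * B))) - c • (X * (B' * E - r • (E * B')))
        = P • (B * X' * E) - c • (B' * X * E) - r • (E * B * X') + (r * P) • (E1 * B * X)
          - r • (X * (E1 * B - c • (E * B'))) := by
      have q2 := congrArg (· * B) q1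
      simp only [sub_mul, add_mul, smul_mul_assoc, mul_assoc, f1, f2] at q2
      have e1 : X' * (B * E) = B * (X' * E) := by rw [← mul_assoc, f1, mul_assoc]
      have e2 : X * (B' * E) = B' * (X * E) := by rw [← mul_assoc, f3, mul_assoc]
      simp only [mul_sub, smul_sub, mul_smul_comm, mul_assoc, e1, e2]
      rw [smul_comm P r, q2]
      module
    rw [key]
    exact Submodule.sub_mem _ (Submodule.add_mem _ (Submodule.sub_mem _ (Submodule.sub_mem _
      (Submodule.smul_mem _ _ k1) (Submodule.smul_mem _ _ k2)) (Submodule.smul_mem _ _ k3))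
      (Submodule.smul_mem _ _ k4)) (Submodule.smul_mem _ _ s1)

theorem x_next_mul_rootVec (h : LoopSerre x p s odd) (i d : ℕ) (m n : ℤ) :
    x (i + d + 1) m * rootVec x p i d n ∈ rootMod x p i (d + 1) := by
  obtain ⟨c, hc, hs⟩ := h.x_next_mul_rootVec_shift i d
  exact h.next_of_shift hc hs m n

theorem next_rootMod (h : LoopSerre x p s odd)
    {i d : ℕ} (m : ℤ) {a : A} (ha : a ∈ rootMod x p i d) :
    x (i + d + 1) m * a ∈ rootMod x p i (d + 1) := by
  refine mul_rootMod (fun f hf n => ?_) ha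
  rcases hf.eq_or_lt with rfl | hf
  · exact h.x_next_mul_rootVec i f m n
  · exact rootMod_mono (by omega)
      (h.far_rootMod (d := f) (by omega) _ (rootVec_mem_rootMod le_rfl n))

/-- With respect to node `i + d + 1`, the root vector behaves like its last factor: the earlier part
commutes with that node, so bracketing the Serre relation with it gives the claim. -/
theorem serre_rootVec (h : LoopSerre x p s odd) (i d : ℕ) (hodd : ¬ odd (i + d + 1)) (m n : ℤ) :
    x (i + d + 1) m * x (i + d + 1) m * rootVec x p i d n
      - s • (x (i + d + 1) m * rootVec x p i d n * x (i + d + 1) m)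
      + rootVec x p i d n * x (i + d + 1) m * x (i + d + 1) m = 0 := by
  cases d with
  | zero => exact h.serre _ _ _ _ hodd (Or.inr rfl)
  | succ d =>
    have s1 := h.serre (i + (d + 1) + 1) (i + d + 1) m 0 hodd (Or.inr rfl)
    have f1 := h.far_rootVec i d (i + (d + 1) + 1) (by omega) m n
    simp only [rootVec]
    generalize rootVec x p i d n = B at *
    generalize x (i + (d + 1) + 1) m = E at *
    generalize x (i + d + 1) 0 = F at *
    have f2 : ∀ z, E * (B * z) = B * (E * z) := fun z => by
      rw [← mul_assoc, f1, mul_assoc]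
    have l := congrArg (B * ·) s1
    have r := congrArg (· * B) s1
    simp only [mul_sub, sub_mul, mul_add, add_mul, smul_mul_assoc, mul_smul_comm, mul_assoc,
      smul_sub, f1, f2, mul_zero, zero_mul] at l r ⊢
    linear_combination (norm := module) l - p (i + d + 1) • r

/-- As for `serre_rootVec`: nodes `i + d + 1` and `i + d + 2` commute with everything in the root
vector except its last factor. -/
theorem osc_rootVec (h : LoopSerre x p s odd) (i d : ℕ) (hodd : odd (i + d + 1)) (m n k : ℤ) :
    rootVec x p i d n * x (i + d + 1) m * x (i + d + 2) k * x (i + d + 1) m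
      + x (i + d + 2) k * x (i + d + 1) m * rootVec x p i d n * x (i + d + 1) m
      + x (i + d + 1) m * rootVec x p i d n * x (i + d + 1) m * x (i + d + 2) k
      + x (i + d + 1) m * x (i + d + 2) k * x (i + d + 1) m * rootVec x p i d n
      - s • (x (i + d + 1) m * x (i + d + 2) k * rootVec x p i d n * x (i + d + 1) m) = 0 := by
  cases d with
  | zero => exact h.osc _ _ _ _ hodd
  | succ d =>
    have s1 := h.osc (i + d + 1) 0 m k hodd
    have f1 := h.far_rootVec i d (i + (d + 1) + 1) (by omega) m n
    have g1 := h.far_rootVec i d (i + (d + 1) + 2) (by omega) k n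
    simp only [rootVec]
    have e1 : i + d + 1 + 1 = i + (d + 1) + 1 := by omega
    have e2 : i + d + 1 + 2 = i + (d + 1) + 2 := by omega
    rw [e1, e2] at s1
    generalize rootVec x p i d n = B at *
    generalize x (i + (d + 1) + 1) m = E at *
    generalize x (i + (d + 1) + 2) k = X at *
    generalize x (i + d + 1) 0 = F at *
    have f2 : ∀ z, E * (B * z) = B * (E * z) := fun z => by
      rw [← mul_assoc, f1, mul_assoc]
    have g2 : ∀ z, X * (B * z) = B * (X * z) := fun z => by
      rw [← mul_assoc, g1, mul_assoc]
    have l := congrArg (B * ·) s1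
    have r := congrArg (· * B) s1
    simp only [mul_sub, sub_mul, mul_add, add_mul, smul_mul_assoc, mul_smul_comm, mul_assoc,
      smul_sub, f1, f2, g1, g2, mul_zero, zero_mul] at l r ⊢
    linear_combination (norm := module) l - p (i + d + 1) • r

theorem sq_rootVec (h : LoopSerre x p s odd) (i d : ℕ) (m k n : ℤ) :
    x (i + d + 1) m * (x (i + d + 1) k * rootVec x p i d n) ∈ rootMod x p i (d + 1) := by
  obtain ⟨c, hc, hs⟩ := h.x_next_mul_rootVec_shift i d
  -- Slide the inner mode until both factors of node `i + d + 1` agree. Their product is then a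
  -- square: zero at an odd node, and moved to the right by the Serre relation at an even one.
  refine mode_transfer _ hc
    (fun k n => x (i + d + 1) m * (x (i + d + 1) k * rootVec x p i d n)) (fun k n => ?_) m k n ?_
  · have := h.next_rootMod m (hs k n)
    rwa [mul_sub, mul_smul_comm] at this
  · rw [← mul_assoc]
    by_cases ho : odd (i + d + 1)
    · rw [h.odd_sq _ _ ho, zero_mul]
      exact zero_mem _
    · have e := h.serre_rootVec i d ho m (n + k - m)
      have i1 : i + 1 ≤ i + d + 1 := by omega
      rw [sub_add, sub_eq_zero] at e
      rw [e]
      exact Submodule.sub_mem _ (Submodule.smul_mem _ _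
        (mul_x_mem_rootMod (h.x_next_mul_rootVec i d _ _) i1 _))
        (mul_x_mem_rootMod (mul_x_mem_rootMod (rootVec_mem_rootMod (by omega) _) i1 _) i1 _)

theorem x_last_mul_rootVec (h : LoopSerre x p s odd) (i d : ℕ) (m n : ℤ) :
    x (i + d + 1) m * rootVec x p i (d + 1) n ∈ rootMod x p i (d + 1) := by
  rw [rootVec, mul_sub, mul_smul_comm, ← mul_assoc]
  exact Submodule.sub_mem _ (mul_x_mem_rootMod (h.x_next_mul_rootVec i d _ _) (by omega) _)
    (Submodule.smul_mem _ _ (h.sq_rootVec i d m 0 n))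

theorem x_penultimate_mul_rootVec (h : LoopSerre x p s odd) (i d : ℕ) (m n : ℤ) :
    x (i + d + 1) m * rootVec x p i (d + 2) n ∈ rootMod x p i (d + 2) := by
  have i1 : i + 1 ≤ i + d + 1 := by omega
  have i2 : i + 1 ≤ i + d + 2 := by omega
  obtain ⟨c, hc, hs⟩ := h.x_next_mul_rootVec_shift i d
  have mono := rootMod_mono (x := x) (p := p) (i := i) (Nat.le_succ (d + 1))
  -- This is the one term in the expansion of the root vector of index `d + 2` that is not already
  -- covered. After the modes of node `i + d + 1` are made equal it has the form E X E B, which the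
  -- oscillation relation rewrites at an odd node and the Serre relation of E and X at an even one.
  have key : ∀ k n, x (i + d + 1) m * (x (i + d + 2) 0 * (x (i + d + 1) k * rootVec x p i d n))
      ∈ rootMod x p i (d + 2) := by
    intro k n
    refine mode_transfer _ hc
      (fun k n => x (i + d + 1) m * (x (i + d + 2) 0 * (x (i + d + 1) k * rootVec x p i d n)))
      (fun k n => ?_) m k n ?_
    · have := h.next_rootMod m (h.far_rootMod le_rfl 0 (hs k n))
      rw [mul_sub, mul_sub, mul_smul_comm, mul_smul_comm] at this
      exact mono this
    · generalize n + k - m = n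
      have f1 := h.far_rootVec i d (i + d + 2) le_rfl 0 n
      have a1 := h.x_next_mul_rootVec i d m n
      have a2 := mul_x_mem_rootMod (h.sq_rootVec i d m m n) i2 0
      have a3 := h.next_rootMod 0 (h.sq_rootVec i d m m n)
      have a4 := mul_x_mem_rootMod (h.next_rootMod 0 a1) i1 m
      have a5 := mul_x_mem_rootMod (mul_x_mem_rootMod a1 i1 m) i2 0
      have a6 := mul_x_mem_rootMod (mul_x_mem_rootMod a1 i2 0) i1 m
      have a7 := mul_x_mem_rootMod (mul_x_mem_rootMod (mul_x_mem_rootMod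
        (rootVec_mem_rootMod (x := x) (p := p) (i := i) (show d ≤ d + 2 by omega) n) i1 m) i2 0)
        i1 m
      by_cases ho : odd (i + d + 1)
      · have e := h.osc_rootVec i d ho m n 0
        rw [show i + (d + 1) + 1 = i + d + 2 by omega] at a4
        generalize x (i + d + 1) m = E at *
        generalize x (i + d + 2) 0 = X at *
        generalize rootVec x p i d n = B at *
        have e2 : E * (X * (E * B)) = s • (E * B * X * E) - B * E * X * E - X * (E * B) * E
            - E * B * E * X := by
          simp only [mul_assoc] at e ⊢
          rw [← mul_assoc X B E, f1, mul_assoc] at e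
          linear_combination (norm := module) e
        rw [e2]
        exact Submodule.sub_mem _ (Submodule.sub_mem _ (Submodule.sub_mem _
          (Submodule.smul_mem _ _ (mono a6)) a7) a4) (mono a5)
      · have e := h.serre (i + d + 1) (i + d + 2) m 0 ho (Or.inl rfl)
        rw [← Submodule.smul_mem_iff _ h.s_ne]
        rw [show i + (d + 1) + 1 = i + d + 2 by omega] at a3
        generalize x (i + d + 1) m = E at *
        generalize x (i + d + 2) 0 = X at *
        generalize rootVec x p i d n = B at *
        have e2 : s • (E * (X * (E * B))) = E * (E * B) * X + X * (E * (E * B)) := by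
          have e3 := congrArg (· * B) e
          simp only [mul_assoc, add_mul, sub_mul, smul_mul_assoc, zero_mul, f1] at e3 ⊢
          linear_combination (norm := module) (-1 : ℂ) • e3
        rw [e2]
        exact Submodule.add_mem _ (mono a2) a3
  have f1 := h.far_rootVec i d (i + d + 2) le_rfl 0 n
  have hY : x (i + d + 1) m * rootVec x p i (d + 2) n
      = x (i + d + 1) m * rootVec x p i (d + 1) n * x (i + d + 2) 0
        - p (i + d + 2) • (x (i + d + 1) m * rootVec x p i d n * x (i + d + 2) 0 * x (i + d + 1) 0)
        + (p (i + d + 2) * p (i + d + 1)) •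
          (x (i + d + 1) m * (x (i + d + 2) 0 * (x (i + d + 1) 0 * rootVec x p i d n))) := by
    have e : rootVec x p i (d + 2) n = rootVec x p i (d + 1) n * x (i + d + 2) 0
      - p (i + d + 2) • (x (i + d + 2) 0 * rootVec x p i (d + 1) n) := rfl
    have e' : x (i + d + 2) 0 * rootVec x p i (d + 1) n =
        rootVec x p i d n * x (i + d + 2) 0 * x (i + d + 1) 0
        - p (i + d + 1) • (x (i + d + 2) 0 * (x (i + d + 1) 0 * rootVec x p i d n)) := by
      rw [rootVec, mul_sub, mul_smul_comm, ← mul_assoc, f1]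
    rw [e, e']
    simp only [mul_sub, mul_smul_comm, smul_sub, mul_assoc]
    module
  rw [hY]
  exact Submodule.add_mem _ (Submodule.sub_mem _
    (mono (mul_x_mem_rootMod (h.x_last_mul_rootVec i d m n) i2 _)) (Submodule.smul_mem _ _
    (mono (mul_x_mem_rootMod (mul_x_mem_rootMod (h.x_next_mul_rootVec i d m n) i2 _) i1 _))))
    (Submodule.smul_mem _ _ (key 0 n))

/-- Node `k` commutes with the last factor unless it is the last or the second to last node, so
induction on `d` leaves only those two cases. -/
theorem x_inner_mul_rootVec (h : LoopSerre x p s odd)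
    (i d k : ℕ) (hk : i < k) (hkd : k ≤ i + d) (m n : ℤ) :
    x k m * rootVec x p i d n ∈ rootMod x p i d := by
  induction d with
  | zero => omega
  | succ d ih =>
    rcases hkd.eq_or_lt with rfl | hkd'
    · exact h.x_last_mul_rootVec i d m n
    · have hkd'' : k ≤ i + d := by omega
      rcases hkd''.eq_or_lt with rfl | hlt
      · obtain ⟨e, rfl⟩ : ∃ e, d = e + 1 := ⟨d - 1, by omega⟩
        exact h.x_penultimate_mul_rootVec i e m n
      · have ih := ih hkd''
        have e : x k m * rootVec x p i (d + 1) n =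
            x k m * rootVec x p i d n * x (i + d + 1) 0
              - p (i + d + 1) • (x (i + d + 1) 0 * (x k m * rootVec x p i d n)) := by
          rw [rootVec, mul_sub, mul_smul_comm, ← mul_assoc, ← mul_assoc (x k m) (x (i + d + 1) 0),
            ← h.far k (i + d + 1) m 0 (by omega), mul_assoc (x (i + d + 1) 0)]
        rw [e]
        exact Submodule.sub_mem _
          (rootMod_mono (Nat.le_succ d) (mul_x_mem_rootMod ih (by omega) _))
          (Submodule.smul_mem _ _ (h.next_rootMod 0 ih))

theorem x_mul_rootVec_mem (h : LoopSerre x p s odd) (i d k : ℕ) (hk : i < k) (m n : ℤ) :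
    x k m * rootVec x p i d n ∈ degOne x p i := by
  rcases le_or_gt k (i + d) with h1 | h1
  · exact rootMod_le_degOne (h.x_inner_mul_rootVec i d k hk h1 m n)
  · rcases Nat.eq_or_lt_of_le (Nat.succ_le_of_lt h1) with h2 | h2
    · subst h2
      exact rootMod_le_degOne (h.x_next_mul_rootVec i d m n)
    · exact rootMod_le_degOne (h.far_rootMod (by omega) m (rootVec_mem_rootMod le_rfl n))

theorem degOne_mul_tail {i : ℕ} :
    degOne x p i * Subalgebra.toSubmodule (tailAlg x (i + 1)) = degOne x p i := by
  rw [degOne, mul_assoc, Subalgebra.isIdempotentElem_toSubmodule _]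

theorem tail_mul_degOne (h : LoopSerre x p s odd) (i : ℕ) :
    Subalgebra.toSubmodule (tailAlg x (i + 1)) * degOne x p i ≤ degOne x p i := by
  refine Submodule.mul_le.2 fun g hg => ?_
  induction (show g ∈ Algebra.adjoin ℂ _ from hg) using Algebra.adjoin_induction with
  | mem y hy =>
    obtain ⟨k, m, hk, rfl⟩ := hy
    intro a ha
    refine mul_left_mem (P := degOne x p i) ?_ degOne_mul_tail.le ha
    rintro _ ⟨e, n, rfl⟩
    exact h.x_mul_rootVec_mem i e k hk m n
  | algebraMap r => intro a ha; rw [← Algebra.smul_def]; exact Submodule.smul_mem _ _ ha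
  | add y z hy hz ihy ihz =>
    intro a ha; rw [add_mul]; exact Submodule.add_mem _ (ihy hy a ha) (ihz hz a ha)
  | mul y z hy hz ihy ihz =>
    intro a ha; rw [mul_assoc]; exact ihy hy _ (ihz hz a ha)

end LoopSerre

end

end QAff

/-! ### Products of two root vectors, and sorting -/

namespace QAff

section

variable {A : Type*} [Ring A] [Algebra ℂ A]

/-- The part of degree two in the node `i` with first root vector of length at most `d`. -/
def degTwo (x : ℕ → ℤ → A) (p : ℕ → ℂ) (i d : ℕ) : Submodule ℂ A :=
  rootSpan x p i d * degOne x p i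

/-- The span of the products of `r` root vectors starting at `i`, ordered by length, times
`tailAlg x (i+1)`. -/
def sortedMod (x : ℕ → ℤ → A) (p : ℕ → ℂ) (i r : ℕ) : Submodule ℂ A :=
  Submodule.span ℂ {y | ∃ l : List (ℕ × ℤ), l.length = r ∧ l.Pairwise (fun a b => a.1 ≤ b.1) ∧
    y = (l.map fun a => rootVec x p i a.1 a.2).prod} *
    Subalgebra.toSubmodule (tailAlg x (i + 1))

namespace LoopSerre

variable {x : ℕ → ℤ → A} {p : ℕ → ℂ} {s : ℂ} {odd : ℕ → Prop}

theorem rootVec_mem_degOne {i : ℕ} (e : ℕ) (n : ℤ) : rootVec x p i e n ∈ degOne x p i :=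
  rootMod_le_degOne (rootVec_mem_rootMod le_rfl n)

theorem degTwo_mono {i d e : ℕ} (h : d ≤ e) : degTwo x p i d ≤ degTwo x p i e :=
  mul_le_mul' (rootSpan_mono h) le_rfl

theorem rootVec_mul_mem_degTwo {i d : ℕ} (n : ℤ) {w : A} (hw : w ∈ degOne x p i) :
    rootVec x p i d n * w ∈ degTwo x p i d :=
  Submodule.mul_mem_mul (rootVec_mem_rootSpan le_rfl n) hw

theorem degTwo_mul_x {i d k : ℕ} {a : A} (ha : a ∈ degTwo x p i d) (hk : i + 1 ≤ k)
    (n : ℤ) : a * x k n ∈ degTwo x p i d := by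
  have h := Submodule.mul_mem_mul ha
    (show x k n ∈ Subalgebra.toSubmodule (tailAlg x (i + 1)) from x_mem_tailAlg hk n)
  rwa [degTwo, mul_assoc, degOne_mul_tail] at h

theorem x_mul_degOne (h : LoopSerre x p s odd)
    {i k : ℕ} (hk : i + 1 ≤ k) (n : ℤ) {w : A} (hw : w ∈ degOne x p i) :
    x k n * w ∈ degOne x p i :=
  h.tail_mul_degOne i (Submodule.mul_mem_mul
    (show x k n ∈ Subalgebra.toSubmodule (tailAlg x (i + 1)) from x_mem_tailAlg hk n) hw)

theorem rootMod_mul_degOne (h : LoopSerre x p s odd)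
    (i d : ℕ) : rootMod x p i d * degOne x p i ≤ degTwo x p i d := by
  rw [rootMod, mul_assoc]
  exact mul_le_mul' le_rfl (h.tail_mul_degOne i)

theorem mul_mem_degTwo (h : LoopSerre x p s odd)
    {i d : ℕ} {a w : A} (ha : a ∈ rootMod x p i d) (hw : w ∈ degOne x p i) :
    a * w ∈ degTwo x p i d :=
  h.rootMod_mul_degOne i d (Submodule.mul_mem_mul ha hw)

theorem far_degTwo (h : LoopSerre x p s odd) {i d k : ℕ} (hk : i + d + 2 ≤ k) (m : ℤ) {a : A}
    (ha : a ∈ degTwo x p i d) : x k m * a ∈ degTwo x p i d := by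
  refine mul_left_mem (P := rootMod x p i d) ?_ (h.rootMod_mul_degOne i d) ha
  rintro _ ⟨e, n, he, rfl⟩
  exact h.far_rootMod hk m (rootVec_mem_rootMod he n)

theorem next_degTwo (h : LoopSerre x p s odd) {i d : ℕ} (m : ℤ) {a : A} (ha : a ∈ degTwo x p i d) :
    x (i + d + 1) m * a ∈ degTwo x p i (d + 1) := by
  refine mul_left_mem (P := rootMod x p i (d + 1)) ?_ (h.rootMod_mul_degOne i (d + 1)) ha
  rintro _ ⟨e, n, he, rfl⟩
  exact h.next_rootMod m (rootVec_mem_rootMod he n)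

/-- This is the critical case of the exchange of two root vectors. The point is that the first index
stays at `d`, although a single product with node `i + d + 1` would raise it to `d + 1`. -/
theorem x_mul_rootVec_sq (h : LoopSerre x p s odd) (i d : ℕ) (m n k : ℤ) :
    x (i + d + 1) m * (rootVec x p i d n * rootVec x p i d k) ∈ degTwo x p i d := by
  induction d generalizing m n k with
  | zero =>
    obtain ⟨c, hc, hs⟩ := h.x_next_mul_rootVec_shift i 0
    refine mode_transfer _ hc
      (fun m n => x (i + 0 + 1) m * (rootVec x p i 0 n * rootVec x p i 0 k))
      (fun m n => ?_) (n + m - k) m n ?_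
    · have := h.mul_mem_degTwo (hs m n) (rootVec_mem_degOne 0 k)
      rwa [sub_mul, smul_mul_assoc, mul_assoc, mul_assoc] at this
    · rw [sub_sub_cancel]
      generalize n + m - k = m
      by_cases ho : odd i
      · have := h.odd_sq i k ho
        simp only [rootVec, this, mul_zero]
        exact zero_mem _
      · have e := h.serre i (i + 1) k m ho (Or.inl rfl)
        have e2 : x (i + 0 + 1) m * (rootVec x p i 0 k * rootVec x p i 0 k)
            = s • (rootVec x p i 0 k * (x (i + 1) m * rootVec x p i 0 k))
              - rootVec x p i 0 k * (rootVec x p i 0 k * x (i + 1) m) := by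
          simp only [rootVec, add_zero, mul_assoc] at e ⊢
          linear_combination (norm := module) e
        rw [e2]
        refine Submodule.sub_mem _ (Submodule.smul_mem _ _ (rootVec_mul_mem_degTwo _ ?_))
          (rootVec_mul_mem_degTwo _ ?_)
        · exact h.x_mul_degOne le_rfl _ (rootVec_mem_degOne 0 k)
        · exact rootMod_le_degOne (mul_x_mem_rootMod (rootVec_mem_rootMod (d := 0) le_rfl _)
            le_rfl _)
  | succ d ih =>
    obtain ⟨c, hc, hs⟩ := h.x_next_mul_rootVec_shift i (d + 1)
    refine mode_transfer _ hc
      (fun m n => x (i + (d + 1) + 1) m * (rootVec x p i (d + 1) n * rootVec x p i (d + 1) k))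
      (fun m n => ?_) (n + m - k) m n ?_
    · have := h.mul_mem_degTwo (hs m n) (rootVec_mem_degOne (d + 1) k)
      rwa [sub_mul, smul_mul_assoc, mul_assoc, mul_assoc] at this
    · rw [sub_sub_cancel]
      generalize n + m - k = m
      have hX : i + (d + 1) + 1 = i + d + 2 := by omega
      rw [hX]
      have i1 : i + 1 ≤ i + d + 1 := by omega
      have i2 : i + 1 ≤ i + d + 2 := by omega
      have mono := degTwo_mono (x := x) (p := p) (i := i) (Nat.le_succ d)
      have f1 := h.far_rootVec i d (i + d + 2) le_rfl m k
      have f2 : ∀ z, x (i + d + 2) m * (rootVec x p i d k * z)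
          = rootVec x p i d k * (x (i + d + 2) m * z) := fun z => by
        rw [← mul_assoc, f1, mul_assoc]
      have hB := rootVec_mem_degOne (x := x) (p := p) (i := i) d k
      have hY := rootVec_mem_degOne (x := x) (p := p) (i := i) (d + 1) k
      have b1 : ∀ w ∈ degOne x p i, rootVec x p i d k * w ∈ degTwo x p i (d + 1) :=
        fun w hw => mono (rootVec_mul_mem_degTwo k hw)
      have b2 : ∀ w ∈ degOne x p i, x (i + d + 1) 0 * (rootVec x p i d k * w)
          ∈ degTwo x p i (d + 1) := fun w hw => by
        rw [← mul_assoc]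
        exact h.mul_mem_degTwo (h.x_next_mul_rootVec i d 0 k) hw
      have hE : ∀ w ∈ degOne x p i, x (i + d + 1) 0 * w ∈ degOne x p i :=
        fun w hw => h.x_mul_degOne i1 0 hw
      have hXw : ∀ w ∈ degOne x p i, x (i + d + 2) m * w ∈ degOne x p i :=
        fun w hw => h.x_mul_degOne i2 m hw
      have c1 := ih 0 k k
      have c2 := mono (degTwo_mul_x (h.far_degTwo le_rfl m c1) i1 0)
      have c3 := h.next_degTwo 0 (h.far_degTwo le_rfl m c1)
      have c4 := degTwo_mul_x (h.next_degTwo 0 c1) i2 m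
      -- Both copies of E have mode 0, as they come from the defining brackets, so the equal-mode
      -- relations apply directly.
      have key : x (i + d + 2) m * (x (i + d + 1) 0 * (rootVec x p i d k *
          (x (i + d + 1) 0 * rootVec x p i d k))) ∈ degTwo x p i (d + 1) := by
        by_cases ho : odd (i + d + 1)
        · have e := h.osc_rootVec i d ho 0 k m
          have d1 := b1 _ (hE _ (hXw _ (hE _ hB)))
          have d2 := b2 _ (hE _ (hXw _ hB))
          have d3 := b2 _ (hXw _ (hE _ hB))
          generalize x (i + d + 1) 0 = E at *
          generalize x (i + d + 2) m = X at *
          generalize rootVec x p i d k = B at *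
          have e2 : X * (E * (B * (E * B))) = s • (E * (B * (X * (E * B))))
              - B * (E * (X * (E * B))) - E * (B * (E * (X * B))) - E * (X * (E * (B * B))) := by
            have e3 := congrArg (· * B) e
            simp only [mul_assoc, add_mul, sub_mul, smul_mul_assoc, zero_mul, f2] at e3 ⊢
            linear_combination (norm := module) e3
          rw [e2]
          exact Submodule.sub_mem _ (Submodule.sub_mem _ (Submodule.sub_mem _
            (Submodule.smul_mem _ _ d3) d1) d2) c3
        · have e := h.serre (i + d + 1) (i + d + 2) 0 m ho (Or.inl rfl)
          have e' := h.serre_rootVec i d ho 0 k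
          have d1 := b1 _ (hXw _ (hE _ (hE _ hB)))
          rw [← Submodule.smul_mem_iff _ h.s_ne]
          generalize x (i + d + 1) 0 = E at *
          generalize x (i + d + 2) m = X at *
          generalize rootVec x p i d k = B at *
          -- The Serre relation of E and X times B², and that of E and B between X and B, share the
          -- uncontrolled term X E E B B; it cancels in their difference.
          have e2 : s • (X * (E * (B * (E * B)))) = s • (E * (X * (E * (B * B))))
              - E * (E * (B * B)) * X + B * (X * (E * (E * B))) := by
            have e3 := congrArg (· * (B * B)) e
            have e4 := congrArg (X * · * B) e'
            simp only [mul_assoc, mul_add, mul_sub, mul_smul_comm, add_mul, sub_mul,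
              smul_mul_assoc, zero_mul, mul_zero, f1, f2] at e3 e4 ⊢
            linear_combination (norm := module) e3 - e4
          rw [e2]
          exact Submodule.add_mem _ (Submodule.sub_mem _ (Submodule.smul_mem _ _ c3) c4) d1
      have d0 := b1 _ (hXw _ (hE _ hY))
      have eY : rootVec x p i (d + 1) k = rootVec x p i d k * x (i + d + 1) 0
        - p (i + d + 1) • (x (i + d + 1) 0 * rootVec x p i d k) := rfl
      have e : x (i + d + 2) m * (rootVec x p i (d + 1) k * rootVec x p i (d + 1) k)
          = rootVec x p i d k * (x (i + d + 2) m * (x (i + d + 1) 0 * rootVec x p i (d + 1) k))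
            - p (i + d + 1) • (x (i + d + 2) m * (x (i + d + 1) 0 *
              (rootVec x p i d k * rootVec x p i d k)) * x (i + d + 1) 0)
            + (p (i + d + 1) * p (i + d + 1)) • (x (i + d + 2) m * (x (i + d + 1) 0 *
              (rootVec x p i d k * (x (i + d + 1) 0 * rootVec x p i d k)))) := by
        rw [eY]
        simp only [mul_sub, sub_mul, smul_sub, mul_smul_comm, smul_mul_assoc, mul_assoc, f2]
        module
      rw [e]
      exact Submodule.add_mem _ (Submodule.sub_mem _ d0 (Submodule.smul_mem _ _ c2))
        (Submodule.smul_mem _ _ key)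

/-- Two root vectors in the wrong order can be rewritten so that the first one gets shorter. -/
theorem rootVec_mul_rootVec (h : LoopSerre x p s odd) (i d e : ℕ) (he : e ≤ d) (m n : ℤ) :
    rootVec x p i (d + 1) m * rootVec x p i e n ∈ degTwo x p i d := by
  induction d generalizing e with
  | zero =>
    obtain rfl : e = 0 := by omega
    rw [rootVec.eq_2, sub_mul, mul_assoc, smul_mul_assoc, mul_assoc]
    exact Submodule.sub_mem _ (rootVec_mul_mem_degTwo _
      (h.x_mul_degOne (by omega) _ (rootVec_mem_degOne _ _)))
      (Submodule.smul_mem _ _ (h.x_mul_rootVec_sq i 0 0 m n))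
  | succ d ih =>
    rw [rootVec.eq_2, sub_mul, mul_assoc, smul_mul_assoc, mul_assoc]
    refine Submodule.sub_mem _ (rootVec_mul_mem_degTwo _
      (h.x_mul_degOne (by omega) _ (rootVec_mem_degOne _ _))) (Submodule.smul_mem _ _ ?_)
    rcases he.eq_or_lt with rfl | he
    · exact h.x_mul_rootVec_sq i (d + 1) 0 m n
    · exact degTwo_mono (Nat.le_succ d) (h.far_degTwo (by omega) 0 (ih e (by omega)))

theorem sortedMod_zero (i : ℕ) :
    sortedMod x p i 0 = Subalgebra.toSubmodule (tailAlg x (i + 1)) := by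
  have : {y : A | ∃ l : List (ℕ × ℤ), l.length = 0 ∧ l.Pairwise (fun a b => a.1 ≤ b.1) ∧
      y = (l.map fun a => rootVec x p i a.1 a.2).prod} = {1} := by
    ext y
    simp only [Set.mem_ofPred_eq, Set.mem_singleton_iff, List.length_eq_zero_iff]
    constructor
    · rintro ⟨l, rfl, -, rfl⟩; simp
    · rintro rfl; exact ⟨[], rfl, List.Pairwise.nil, by simp⟩
  rw [sortedMod, this, ← Submodule.one_eq_span, one_mul]

theorem sortedMod_succ_le (i r : ℕ) :
    sortedMod x p i (r + 1) ≤ degOne x p i * sortedMod x p i r := by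
  rw [sortedMod, Submodule.mul_le]
  intro a ha g hg
  induction ha using Submodule.span_induction with
  | zero => rw [zero_mul]; exact zero_mem _
  | add a b _ _ iha ihb => rw [add_mul]; exact Submodule.add_mem _ iha ihb
  | smul c a _ iha => rw [smul_mul_assoc]; exact Submodule.smul_mem _ _ iha
  | mem a ha =>
    obtain ⟨l, hl, hs, rfl⟩ := ha
    cases l with
    | nil => simp at hl
    | cons b l =>
      rw [List.map_cons, List.prod_cons, mul_assoc]
      refine Submodule.mul_mem_mul (rootVec_mem_degOne _ _) (Submodule.mul_mem_mul
        (Submodule.subset_span ⟨l, by simpa using hl, (List.pairwise_cons.1 hs).2, rfl⟩) hg)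

/-- The two claims are proved together by induction on `r`: stability under later nodes in degree `r
+ 1` uses the first claim in degree `r`, and sorting uses both. -/
theorem rootVec_mul_sortedMod (h : LoopSerre x p s odd) (i r : ℕ) :
    (∀ (d : ℕ) (n : ℤ) (a : A), a ∈ sortedMod x p i r →
      rootVec x p i d n * a ∈ sortedMod x p i (r + 1)) ∧
    Subalgebra.toSubmodule (tailAlg x (i + 1)) * sortedMod x p i r ≤ sortedMod x p i r := by
  induction r with
  | zero =>
    rw [sortedMod_zero, Subalgebra.isIdempotentElem_toSubmodule _]
    refine ⟨fun d n a ha => Submodule.mul_mem_mul (Submodule.subset_span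
      ⟨[(d, n)], rfl, List.pairwise_singleton _ _, by simp⟩) ha, le_rfl⟩
  | succ r ih =>
    obtain ⟨ih1, ih2⟩ := ih
    have hdeg : degOne x p i * sortedMod x p i r ≤ sortedMod x p i (r + 1) := by
      rw [degOne, mul_assoc]
      refine (mul_le_mul' le_rfl ih2).trans (Submodule.mul_le.2 fun y hy a ha => ?_)
      induction hy using Submodule.span_induction with
      | zero => rw [zero_mul]; exact zero_mem _
      | add y z _ _ iha ihb => rw [add_mul]; exact Submodule.add_mem _ iha ihb
      | smul c y _ iha => rw [smul_mul_assoc]; exact Submodule.smul_mem _ _ iha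
      | mem y hy =>
        obtain ⟨d, n, rfl⟩ := hy
        exact ih1 d n a ha
    have hG : Subalgebra.toSubmodule (tailAlg x (i + 1)) * sortedMod x p i (r + 1)
        ≤ sortedMod x p i (r + 1) := by
      refine (mul_le_mul' le_rfl (sortedMod_succ_le i r)).trans ?_
      rw [← mul_assoc]
      exact (mul_le_mul' (h.tail_mul_degOne i) le_rfl).trans hdeg
    refine ⟨fun d => ?_, hG⟩
    induction d using Nat.strong_induction_on with
    | _ d ihd =>
    intro n a ha
    refine mul_left_mem (P := sortedMod x p i (r + 2)) ?_
      (by rw [sortedMod, mul_assoc, Subalgebra.isIdempotentElem_toSubmodule _]) ha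
    rintro _ ⟨l, hl, hs, rfl⟩
    cases l with
    | nil => simp at hl
    | cons b l =>
      have hs' := List.pairwise_cons.1 hs
      have one_mem' : (1 : A) ∈ Subalgebra.toSubmodule (tailAlg x (i + 1)) :=
        one_mem (tailAlg x (i + 1))
      rcases le_or_gt d b.1 with hd | hd
      · rw [← mul_one (rootVec x p i d n * _)]
        refine Submodule.mul_mem_mul (Submodule.subset_span
          ⟨(d, n) :: b :: l, by simpa using hl, List.pairwise_cons.2 ⟨?_, hs⟩, by simp⟩) one_mem'
        intro c hc
        rcases List.mem_cons.1 hc with rfl | hc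
        · exact hd
        · exact hd.trans (hs'.1 c hc)
      · obtain ⟨d, rfl⟩ : ∃ e, d = e + 1 := ⟨d - 1, by omega⟩
        rw [List.map_cons, List.prod_cons, ← mul_assoc]
        -- The exchange lowers the index of the first factor, and the remaining factors reassemble
        -- into sorted products of `r + 1` root vectors, so the induction on `d` applies.
        have h1 := h.rootVec_mul_rootVec i d b.1 (by omega) n b.2
        have h2 : (l.map fun a => rootVec x p i a.1 a.2).prod ∈ sortedMod x p i r := by
          rw [← mul_one (List.prod _)]
          exact Submodule.mul_mem_mul
            (Submodule.subset_span ⟨l, by simpa using hl, hs'.2, rfl⟩) one_mem'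
        have h3 := Submodule.mul_mem_mul h1 h2
        rw [degTwo, mul_assoc] at h3
        have h4 := mul_le_mul' (le_refl (rootSpan x p i d)) hdeg h3
        refine (Submodule.mul_le (P := sortedMod x p i (r + 2))).2 (fun y hy a ha => ?_) h4
        induction hy using Submodule.span_induction with
        | zero => rw [zero_mul]; exact zero_mem _
        | add y z _ _ iha ihb => rw [add_mul]; exact Submodule.add_mem _ iha ihb
        | smul c y _ iha => rw [smul_mul_assoc]; exact Submodule.smul_mem _ _ iha
        | mem y hy =>
          obtain ⟨e, n, he, rfl⟩ := hy
          exact ihd e (by omega) n a ha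

/-- `tailAlg x i` is spanned by sorted products of root vectors starting at `i` times
`tailAlg x (i+1)`. -/
theorem tailAlg_le (h : LoopSerre x p s odd) (i : ℕ) :
    Subalgebra.toSubmodule (tailAlg x i) ≤ ⨆ r, sortedMod x p i r := by
  set S : Submodule ℂ A := ⨆ r, sortedMod x p i r
  have step : ∀ u : A, (∀ r, ∀ a ∈ sortedMod x p i r, u * a ∈ S) → ∀ a ∈ S, u * a ∈ S := by
    intro u hu
    have : S ≤ S.comap (LinearMap.mulLeft ℂ u) := iSup_le fun r a ha => hu r a ha
    exact fun a ha => this ha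
  have stable : ∀ u ∈ tailAlg x i, ∀ a ∈ S, u * a ∈ S := by
    intro u hu
    induction hu using Algebra.adjoin_induction with
    | mem y hy =>
      obtain ⟨k, n, hk, rfl⟩ := hy
      refine step _ fun r a ha => ?_
      rcases hk.eq_or_lt with rfl | hk
      · exact Submodule.mem_iSup_of_mem (r + 1) ((h.rootVec_mul_sortedMod i r).1 0 n a ha)
      · exact Submodule.mem_iSup_of_mem r ((h.rootVec_mul_sortedMod i r).2
          (Submodule.mul_mem_mul (show x k n ∈ Subalgebra.toSubmodule (tailAlg x (i + 1)) from
            x_mem_tailAlg hk n) ha))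
    | algebraMap r => intro a ha; rw [← Algebra.smul_def]; exact Submodule.smul_mem _ _ ha
    | add y z _ _ ihy ihz =>
      intro a ha; rw [add_mul]; exact Submodule.add_mem _ (ihy a ha) (ihz a ha)
    | mul y z _ _ ihy ihz => intro a ha; rw [mul_assoc]; exact ihy _ (ihz a ha)
  intro u hu
  have h1 : (1 : A) ∈ S := Submodule.mem_iSup_of_mem 0 (by
    rw [sortedMod_zero]; exact one_mem (tailAlg x (i + 1)))
  simpa using stable u hu 1 h1

/-- If the generators vanish from the node `L` on, then the algebra generated by the nodes `≥ i` is
spanned by the products of root vectors in lexicographic order. -/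
theorem tailAlg_le_span (h : LoopSerre x p s odd) (L : ℕ) (hL : ∀ k n, L ≤ k → x k n = 0) (i : ℕ) :
    Subalgebra.toSubmodule (tailAlg x i) ≤ Submodule.span ℂ {y | ∃ l : List ((ℕ ×ₗ ℕ) × ℤ),
      l.Pairwise (fun a b => a.1 ≤ b.1) ∧ (∀ a ∈ l, i ≤ (ofLex a.1).1) ∧
      y = (l.map fun a => rootVec x p (ofLex a.1).1 (ofLex a.1).2 a.2).prod} := by
  rcases le_or_gt L i with hi | hi
  · have : tailAlg x i ≤ ⊥ := by
      refine Algebra.adjoin_le ?_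
      rintro _ ⟨k, n, hk, rfl⟩
      rw [hL k n (hi.trans hk)]
      exact zero_mem (⊥ : Subalgebra ℂ A)
    intro y hy
    obtain ⟨c, rfl⟩ := Algebra.mem_bot.1 (this hy)
    rw [Algebra.algebraMap_eq_smul_one]
    exact Submodule.smul_mem _ _ (Submodule.subset_span ⟨[], List.Pairwise.nil, by simp, by simp⟩)
  · have ih := h.tailAlg_le_span L hL (i + 1)
    refine (h.tailAlg_le i).trans (iSup_le fun r => ?_)
    rw [sortedMod]
    refine (mul_le_mul' le_rfl ih).trans ?_
    rw [Submodule.span_mul_span]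
    refine Submodule.span_mono ?_
    rintro _ ⟨_, ⟨l, -, hs, rfl⟩, _, ⟨l', hs', hl', rfl⟩, rfl⟩
    refine ⟨l.map (fun a => (toLex (i, a.1), a.2)) ++ l', ?_, ?_, ?_⟩
    · rw [List.pairwise_append]
      refine ⟨?_, hs', ?_⟩
      · rw [List.pairwise_map]
        refine hs.imp ?_
        intro a b hab
        exact Prod.Lex.le_iff.2 (Or.inr ⟨rfl, hab⟩)
      · intro a ha b hb
        obtain ⟨c, -, rfl⟩ := List.mem_map.1 ha
        exact Prod.Lex.le_iff.2 (Or.inl (hl' b hb))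
    · intro a ha
      rcases List.mem_append.1 ha with ha | ha
      · obtain ⟨c, -, rfl⟩ := List.mem_map.1 ha
        exact le_rfl
      · exact (Nat.le_succ i).trans (hl' a ha)
    · simp only [List.map_append, List.prod_append, List.map_map]
      rfl
termination_by L - i

end LoopSerre

end

end QAff

/-! ### Grouping a sorted product by roots -/

namespace QAff

theorem sorted_eq_flatMap_filter {B : Type*} [LinearOrder B] [DecidableEq B] (s : List B)
    (hs : s.Pairwise (· < ·)) (l : List (B × ℤ)) (hl : l.Pairwise (fun a b => a.1 ≤ b.1))
    (hm : ∀ a ∈ l, a.1 ∈ s) : l = s.flatMap fun b => l.filter fun a => a.1 = b := by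
  induction s generalizing l with
  | nil =>
    cases l with
    | nil => rfl
    | cons a l => simpa using hm a (by simp)
  | cons b s ih =>
    obtain ⟨hb, hs⟩ := List.pairwise_cons.1 hs
    have split : ∀ l : List (B × ℤ), l.Pairwise (fun a b => a.1 ≤ b.1) → (∀ a ∈ l, b ≤ a.1) →
        l = l.filter (fun a => a.1 = b) ++ l.filter (fun a => a.1 ≠ b) := by
      intro l hl hle
      induction l with
      | nil => rfl
      | cons a l ihl =>
        obtain ⟨ha, hl⟩ := List.pairwise_cons.1 hl
        by_cases hab : a.1 = b
        · have := ihl hl fun c hc => hle c (List.mem_cons_of_mem _ hc)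
          simpa [List.filter_cons, hab] using this
        · have hlt : b < a.1 := lt_of_le_of_ne (hle a (by simp)) (Ne.symm hab)
          have hne : ∀ c ∈ a :: l, c.1 ≠ b := by
            intro c hc
            rcases List.mem_cons.1 hc with rfl | hc
            · exact hab
            · exact (hlt.trans_le (ha c hc)).ne'
          rw [List.filter_eq_nil_iff.2 fun c hc => by simpa using hne c hc,
            List.filter_eq_self.2 fun c hc => by simpa using hne c hc, List.nil_append]
    have hle : ∀ a ∈ l, b ≤ a.1 := by
      intro a ha
      rcases List.mem_cons.1 (hm a ha) with h | h
      · exact h.ge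
      · exact (hb _ h).le
    rw [List.flatMap_cons]
    conv_lhs => rw [split l hl hle]
    congr 1
    rw [ih hs (l.filter fun a => a.1 ≠ b) (hl.filter _) (fun a ha => by
      have h1 := List.mem_filter.1 ha
      exact (List.mem_cons.1 (hm a h1.1)).resolve_left (by simpa using h1.2))]
    refine List.flatMap_congr fun c hc => ?_
    rw [List.filter_filter]
    refine List.filter_congr fun a _ => ?_
    by_cases hac : a.1 = c
    · simp [hac, (hb c hc).ne']
    · simp [hac]

variable {M N : ℕ} {q : ℂ}

theorem sorted_prod_eq_pbwProduct (l : List (PosRoot M N × ℤ))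
    (hl : l.Pairwise (fun a b => a.1 ≤ b.1)) :
    ∃ (c : PosRoot M N → ℕ) (n : (β : PosRoot M N) → Fin (c β) → ℤ),
      (l.map fun a => rootVector q a.1 a.2).prod = pbwProduct q c n := by
  refine ⟨fun β => (l.filter fun a => a.1 = β).length,
    fun β t => ((l.filter fun a => a.1 = β).get t).2, ?_⟩
  conv_lhs => rw [sorted_eq_flatMap_filter (Finset.univ.sort (· ≤ ·))
    (Finset.sortedLT_sort _).pairwise l hl (by simp)]
  rw [pbwProduct, List.map_flatMap, List.flatMap_def, List.prod_flatten, List.map_map]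
  congr 1
  refine List.map_congr_left fun β _ => ?_
  rw [Function.comp_apply]
  congr 1
  conv_lhs => rw [← List.ofFn_get (l.filter fun a => a.1 = β)]
  rw [List.map_ofFn]
  congr 1
  funext t
  have := (List.mem_filter.1 ((l.filter fun a => a.1 = β).get_mem t)).2
  simp only [Function.comp]
  rw [of_decide_eq_true this]

/-! ### The Drinfel'd generators satisfy the sign-free relations -/

noncomputable section

/-- The generators `X_{i,n}^+`, extended by zero to all natural numbers `i`. -/
def xGen (M N : ℕ) (q : ℂ) (k : ℕ) (n : ℤ) : Uq M N q :=
  if hk : k < M + N - 1 then (Xp q ⟨k, hk⟩ n).val else 0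

end

theorem xGen_of_lt {k : ℕ} (hk : k < M + N - 1) (n : ℤ) :
    xGen M N q k n = (Xp q ⟨k, hk⟩ n).val := dif_pos hk

theorem xGen_of_le {k : ℕ} (hk : M + N - 1 ≤ k) (n : ℤ) : xGen M N q k n = 0 :=
  dif_neg hk.not_gt

theorem xGen_eq {k : ℕ} (hk : k < M + N - 1) (n : ℤ) : xGen M N q k n =
    RingQuot.mkAlgHom ℂ (Rel M N q) (fX 1 ⟨k, hk⟩ n).val := dif_pos hk

theorem cartan_far {k l : ℕ} (h : k + 2 ≤ l) : cartan M k l = 0 := by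
  simp only [cartan, epsForm]
  rw [if_neg (by omega), if_neg (by omega), if_neg (by omega), if_neg (by omega)]
  rfl

theorem cartan_succ (k : ℕ) : cartan M k (k + 1) = - sgn M (k + 1) := by
  have h1 : k ≠ k + 1 + 1 := by omega
  simp [cartan, epsForm, h1]

theorem cartan_succ' (k : ℕ) : cartan M (k + 1) k = - sgn M (k + 1) := by
  have h1 : k ≠ k + 1 + 1 := by omega
  simp [cartan, epsForm, h1.symm]

theorem sgn_eq (M k : ℕ) : sgn M k = 1 ∨ sgn M k = -1 := by
  unfold sgn; split_ifs <;> simp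

theorem cartan_odd {k : ℕ} (h : k + 1 = M) : cartan M k k = 0 := by
  subst h
  simp [cartan, epsForm, sgn]

theorem nodeParity_odd {k : ℕ} (h : k + 1 = M) : nodeParity M k = 1 := if_pos h

theorem nodeParity_even {k : ℕ} (h : k + 1 ≠ M) : nodeParity M k = 0 := if_neg h

theorem nodeParity_mul {k l : ℕ} (h : k ≠ l) : nodeParity M k * nodeParity M l = 0 := by
  by_cases hk : k + 1 = M
  · rw [nodeParity_even (k := l) (by omega), mul_zero]
  · rw [nodeParity_even hk, zero_mul]

theorem sbr_val_even {A : Type*} [Ring A] [Algebra ℂ A] {u : ℂ} {a b : SuperElt A}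
    (h : a.deg * b.deg = 0) : (sbr u a b).val = a.val * b.val - u • (b.val * a.val) := by
  simp [sbr, h]

theorem sbr_val_odd {A : Type*} [Ring A] [Algebra ℂ A] {u : ℂ} {a b : SuperElt A}
    (h : a.deg * b.deg = 1) : (sbr u a b).val = a.val * b.val + u • (b.val * a.val) := by
  simp [sbr, h, ZMod.val_one]

theorem eq_zero_of_add_self {A : Type*} [Ring A] [Algebra ℂ A] {a : A} (h : a + a = 0) :
    a = 0 := by
  have : (2 : ℂ) • a = 0 := by rw [two_smul, h]
  exact (smul_eq_zero.1 this).resolve_left two_ne_zero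

/-- With equal modes, the symmetrised Serre and oscillation relations and the supercommutator at the
odd node become twice a single expression, and 2 is invertible. Extension by zero makes the
relations trivial beyond the diagram. -/
theorem xGen_loopSerre (hq0 : q ≠ 0) (hq : ∀ k : ℕ, 0 < k → q ^ k ≠ 1) :
    LoopSerre (xGen M N q) (qn q M) (q + q⁻¹) (fun k => k + 1 = M) where
  p_ne k := zpow_ne_zero _ hq0
  s_ne h := by
    -- If q + q⁻¹ = 0 then q² = -1, so q would be a fourth root of unity.
    refine hq 4 (by norm_num) ?_
    have h2 : q ^ 2 = -1 := by
      field_simp at h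
      linear_combination h
    calc q ^ 4 = (q ^ 2) ^ 2 := by ring
      _ = 1 := by rw [h2]; norm_num
  far k l m n hkl := by
    by_cases hl : l < M + N - 1
    · have hk : k < M + N - 1 := by omega
      have r := RingQuot.mkAlgHom_rel ℂ
        (Rel.comm (q := q) 1 ⟨k, hk⟩ ⟨l, hl⟩ m n (cartan_far hkl))
      rw [sbr_val_even (nodeParity_mul (by simp; omega))] at r
      simp only [one_smul, map_sub, map_mul, map_zero] at r
      rw [xGen_eq hk, xGen_eq hl]
      exact (sub_eq_zero.1 r).symm
    · rw [xGen_of_le (le_of_not_gt hl), mul_zero, zero_mul]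
  quad k m n := by
    by_cases hl : k + 1 < M + N - 1
    · have hk : k < M + N - 1 := by omega
      have hc : cartan M k (k + 1) = - sgn M (k + 1) := cartan_succ k
      have hs : sgn M (k + 1) ≠ 0 := by rcases sgn_eq M (k + 1) with h | h <;> simp [h]
      have hp : qn q M (k + 1) ≠ 0 := zpow_ne_zero _ hq0
      have r := RingQuot.mkAlgHom_rel ℂ
        (Rel.quad (q := q) 1 ⟨k, hk⟩ ⟨k + 1, hl⟩ m n (by simpa [hc] using hs))
      simp only [hc, map_sub, map_mul, map_smul, Units.val_one, one_mul, zpow_neg] at r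
      rw [← xGen_eq hk, ← xGen_eq hl, ← xGen_eq hk, ← xGen_eq hl] at r
      rw [show q ^ sgn M (k + 1) = qn q M (k + 1) from rfl] at r
      have r' := congrArg (qn q M (k + 1) • ·) r
      simp only [smul_sub, smul_inv_smul₀ hp] at r'
      linear_combination (norm := module) r'
    · simp [xGen_of_le (le_of_not_gt hl)]
  serre k l m n hk hkl := by
    by_cases hlt : k < M + N - 1 ∧ l < M + N - 1
    · obtain ⟨h1, h2⟩ := hlt
      have hc : cartan M k l = 1 ∨ cartan M k l = -1 := by
        rcases hkl with rfl | rfl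
        · rw [cartan_succ]; rcases sgn_eq M (k + 1) with h | h <;> simp [h]
        · rw [cartan_succ']; rcases sgn_eq M (l + 1) with h | h <;> simp [h]
      have r := RingQuot.mkAlgHom_rel ℂ (Rel.serre (q := q) 1 ⟨k, h1⟩ ⟨l, h2⟩ m m n hc hk)
      have e0 : (fX (M := M) (N := N) 1 ⟨k, h1⟩ m).deg = 0 := nodeParity_even hk
      rw [sbr_val_even (by rw [e0, zero_mul]), sbr_val_even (by rw [e0, zero_mul]), map_zero,
        map_add] at r
      have r := eq_zero_of_add_self r
      simp only [map_sub, map_mul, map_smul, ← xGen_eq] at r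
      simp only [mul_sub, sub_mul, mul_smul_comm, smul_mul_assoc, smul_sub, smul_smul,
        mul_inv_cancel₀ hq0, mul_assoc] at r ⊢
      linear_combination (norm := module) r
    · rcases not_and_or.1 hlt with h | h <;> simp [xGen_of_le (le_of_not_gt h)]
  odd_sq k m hk := by
    by_cases h1 : k < M + N - 1
    · have r := RingQuot.mkAlgHom_rel ℂ (Rel.comm (q := q) 1 ⟨k, h1⟩ ⟨k, h1⟩ m m (cartan_odd hk))
      have e0 : (fX (M := M) (N := N) 1 ⟨k, h1⟩ m).deg = 1 := nodeParity_odd hk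
      rw [sbr_val_odd (by rw [e0, one_mul]), one_smul, map_add, map_zero] at r
      have r := eq_zero_of_add_self r
      rwa [map_mul, ← xGen_eq] at r
    · simp [xGen_of_le (le_of_not_gt h1)]
  osc k a b c hk := by
    by_cases h2 : k + 2 < M + N - 1
    · have h1 : k + 1 < M + N - 1 := by omega
      have h0 : k < M + N - 1 := by omega
      have r := RingQuot.mkAlgHom_rel ℂ
        (Rel.oscillation (q := q) 1 ⟨k, h0⟩ ⟨k + 1, h1⟩ ⟨k + 2, h2⟩ a b c b hk rfl rfl)
      have e0 : (fX (M := M) (N := N) 1 ⟨k, h0⟩ a).deg = 0 := nodeParity_even (by simp; omega)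
      have e1 : (fX (M := M) (N := N) 1 ⟨k + 1, h1⟩ b).deg = 1 := nodeParity_odd hk
      have e2 : (fX (M := M) (N := N) 1 ⟨k + 2, h2⟩ c).deg = 0 := nodeParity_even (by simp; omega)
      rw [map_zero, map_add] at r
      have r := eq_zero_of_add_self r
      rw [sbr_val_odd (by simp [sbr, e0, e1, e2]), sbr_val_even (by simp [e2]),
        sbr_val_even (by simp [e0])] at r
      -- The nested bracket has eight terms: E² = 0 kills two, and X B = B X merges two others with
      -- total coefficient q + q⁻¹, leaving five.
      have hEE : xGen M N q (k + 1) b * xGen M N q (k + 1) b = 0 := by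
        have r := RingQuot.mkAlgHom_rel ℂ
          (Rel.comm (q := q) 1 ⟨k + 1, h1⟩ ⟨k + 1, h1⟩ b b (cartan_odd hk))
        rw [sbr_val_odd (by rw [e1, one_mul]), one_smul, map_add, map_zero] at r
        have r := eq_zero_of_add_self r
        rwa [map_mul, ← xGen_eq] at r
      have hXB : xGen M N q (k + 2) c * xGen M N q k a = xGen M N q k a * xGen M N q (k + 2) c := by
        have r := RingQuot.mkAlgHom_rel ℂ
          (Rel.comm (q := q) 1 ⟨k, h0⟩ ⟨k + 2, h2⟩ a c (cartan_far le_rfl))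
        rw [sbr_val_even (by simp [e0])] at r
        simp only [one_smul, map_sub, map_mul, map_zero, ← xGen_eq] at r
        exact (sub_eq_zero.1 r).symm
      simp only [map_add, map_sub, map_mul, map_smul, ← xGen_eq] at r
      generalize xGen M N q (k + 2) c = X at *
      generalize xGen M N q (k + 1) b = E at *
      generalize xGen M N q k a = B at *
      have hEE' : ∀ z, E * (E * z) = 0 := fun z => by rw [← mul_assoc, hEE, zero_mul]
      have hXB' : ∀ z, X * (B * z) = B * (X * z) := fun z => by
        rw [← mul_assoc, hXB, mul_assoc]
      simp only [mul_sub, sub_mul, mul_smul_comm, smul_mul_assoc, smul_sub, smul_smul,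
        mul_inv_cancel₀ hq0, mul_assoc, hEE, hEE', hXB, hXB', mul_zero,
        smul_zero] at r ⊢
      linear_combination (norm := module) r
    · simp [xGen_of_le (le_of_not_gt h2)]

/-! ### Comparison of the two descriptions of root vectors -/

theorem iterBr_deg (i : Fin (M + N - 1)) (n : ℤ) (d : ℕ) (hd : (i : ℕ) + d < M + N - 1) :
    (iterBr q i n d hd).deg = if (i : ℕ) + 1 ≤ M ∧ M ≤ i + d + 1 then 1 else 0 := by
  induction d with
  | zero =>
    simp only [iterBr, Xp, nodeParity]
    congr 1
    exact propext ⟨fun h => by omega, fun h => by omega⟩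
  | succ d ih =>
    simp only [iterBr, sbr, ih, Xp, nodeParity]
    split_ifs <;> first | omega | simp

/-- All signs are trivial: if the node being added is odd, the earlier nodes are all even, so the
two degrees never are both odd. -/
theorem iterBr_val (i : Fin (M + N - 1)) (n : ℤ) (d : ℕ) (hd : (i : ℕ) + d < M + N - 1) :
    (iterBr q i n d hd).val = rootVec (xGen M N q) (qn q M) i d n := by
  induction d with
  | zero => simp [iterBr, rootVec, xGen_of_lt i.2]
  | succ d ih =>
    rw [rootVec, iterBr, sbr_val_even, ih, xGen_of_lt (show (i : ℕ) + d + 1 < M + N - 1 from hd)]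
    · rfl
    · rw [iterBr_deg]
      simp only [Xp, nodeParity]
      split_ifs <;> first | omega | simp

theorem rootVec_eq_zero {i d : ℕ} (h : M + N - 1 ≤ i + d) (n : ℤ) :
    rootVec (xGen M N q) (qn q M) i d n = 0 := by
  cases d with
  | zero => exact xGen_of_le h n
  | succ d => rw [rootVec, xGen_of_le (show M + N - 1 ≤ i + d + 1 from h)]; simp

/-- The positive root `α_i + ⋯ + α_{i+d}`. -/
def posRoot (i d : ℕ) (h : i + d < M + N - 1) : PosRoot M N :=
  ⟨toLex (⟨i, by omega⟩, ⟨i + d, h⟩), Fin.mk_le_mk.2 (Nat.le_add_right i d)⟩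

theorem rootVector_posRoot (i d : ℕ) (h : i + d < M + N - 1) (n : ℤ) :
    rootVector q (posRoot i d h) n = rootVec (xGen M N q) (qn q M) i d n := by
  rw [rootVector, iterBr_val]
  simp [posRoot]

/-- For equal starting nodes, comparing lengths is the same as comparing end nodes, so both
lexicographic orders agree. -/
theorem posRoot_le {i d i' d' : ℕ} (h : i + d < M + N - 1) (h' : i' + d' < M + N - 1)
    (hle : toLex (i, d) ≤ toLex (i', d')) : posRoot i d h ≤ posRoot i' d' h' := by
  rw [← Subtype.coe_le_coe, posRoot, posRoot]
  rw [Prod.Lex.toLex_le_toLex] at hle ⊢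
  simp only [Fin.lt_def, Fin.ext_iff, Fin.le_def] at hle ⊢
  omega

theorem rootVec_prod_mem (l : List ((ℕ ×ₗ ℕ) × ℤ)) (hl : l.Pairwise (fun a b => a.1 ≤ b.1)) :
    (l.map fun a => rootVec (xGen M N q) (qn q M) (ofLex a.1).1 (ofLex a.1).2 a.2).prod ∈
      Submodule.span ℂ {v : Uq M N q |
        ∃ (c : PosRoot M N → ℕ) (n : (β : PosRoot M N) → Fin (c β) → ℤ),
          v = pbwProduct q c n} := by
  by_cases hlt : ∀ a ∈ l, (ofLex a.1).1 + (ofLex a.1).2 < M + N - 1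
  · obtain ⟨c, n, e⟩ := sorted_prod_eq_pbwProduct (q := q)
      (l.pmap (fun (a : (ℕ ×ₗ ℕ) × ℤ)
        (ha : (ofLex a.1).1 + (ofLex a.1).2 < M + N - 1) =>
        (posRoot (ofLex a.1).1 (ofLex a.1).2 ha, a.2)) hlt) (by
        rw [List.pairwise_pmap]
        refine hl.imp ?_
        intro a b hab ha hb
        exact posRoot_le ha hb hab)
    refine Submodule.subset_span ⟨c, n, ?_⟩
    rw [← e, List.map_pmap]
    simp only [rootVector_posRoot, List.pmap_eq_map]
  · push Not at hlt
    obtain ⟨a, ha, hle⟩ := hlt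
    rw [List.prod_eq_zero (List.mem_map.2 ⟨a, ha, rootVec_eq_zero hle a.2⟩)]
    exact zero_mem _

theorem iterBr_mem (i : Fin (M + N - 1)) (n : ℤ) (d : ℕ) (hd : (i : ℕ) + d < M + N - 1) :
    (iterBr q i n d hd).val ∈ UqPlus M N q := by
  have hX : ∀ (k : Fin (M + N - 1)) (m : ℤ), (Xp q k m).val ∈ UqPlus M N q :=
    fun k m => Algebra.subset_adjoin ⟨k, m, rfl⟩
  induction d with
  | zero => exact hX i n
  | succ d ih =>
    exact sub_mem (mul_mem (ih _) (hX _ _))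
      (Subalgebra.smul_mem _ (mul_mem (hX _ _) (ih _)) _)

theorem pbwProduct_mem (c : PosRoot M N → ℕ) (n : (β : PosRoot M N) → Fin (c β) → ℤ) :
    pbwProduct q c n ∈ UqPlus M N q := by
  refine list_prod_mem fun y hy => ?_
  obtain ⟨β, -, rfl⟩ := List.mem_map.1 hy
  refine list_prod_mem fun z hz => ?_
  obtain ⟨t, rfl⟩ := (List.mem_ofFn' _ _).1 hz
  exact iterBr_mem _ _ _ _

theorem UqPlus_le_tailAlg : UqPlus M N q ≤ tailAlg (xGen M N q) 0 := by
  refine Algebra.adjoin_mono ?_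
  rintro _ ⟨i, n, rfl⟩
  exact ⟨i, n, Nat.zero_le _, (xGen_of_lt i.2 n).symm⟩

end QAff

theorem theorem3p5 (M N : ℕ) (q : ℂ) (hq0 : q ≠ 0) (hq : ∀ k : ℕ, 0 < k → q ^ k ≠ 1) :
    Submodule.span ℂ {v : QAff.Uq M N q |
        ∃ (c : QAff.PosRoot M N → ℕ) (n : (β : QAff.PosRoot M N) → Fin (c β) → ℤ),
          v = QAff.pbwProduct q c n} =
      Subalgebra.toSubmodule (QAff.UqPlus M N q) := by
  apply le_antisymm
  · refine Submodule.span_le.2 ?_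
    rintro _ ⟨c, n, rfl⟩
    exact QAff.pbwProduct_mem c n
  · intro y hy
    have h1 := (QAff.xGen_loopSerre hq0 hq).tailAlg_le_span (M + N - 1)
      (fun k n hk => QAff.xGen_of_le hk n) 0 (QAff.UqPlus_le_tailAlg hy)
    refine Submodule.span_le.2 ?_ h1
    rintro _ ⟨l, hl, -, rfl⟩
    exact QAff.rootVec_prod_mem l hl
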